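/- An infinite frieze (of positive integers) is an array $(m_{ij})_{i,j\in\mathbb Z,\ j\ge i-2}$ of integers with $m_{i,i-2}=0$, $m_{i,i-1}=1$, $m_{ij}>0$ for $i\le j$, and $m_{ij}m_{i+1,j+1}-m_{i+1,j}m_{i,j+1}=1$ for all $j\ge i-1$. It has period $n\ge 1$ if its quiddity row $a_i:=m_{ii}$ satisfies $a_{i+n}=a_i$ for all $i$. For $n\ge 1$, $m\ge 0$ let $A_{n,m}$ be the annulus with marked points $1,\dots,n$ on its outer and $n+1,\dots,n+m$ on its inner boundary. Its universal cover is an infinite strip, whose lower boundary line covers the outer boundary and carries marked points $v_k$ ($k\in\mathbb Z$, from left to right), $v_k$ lying over the outer marked point congruent to $k$ modulo $n$; if $m\ge 1$, the upper line covers the inner boundary and carries marked points likewise. An arc of $A_{n,m}$ is an isotopy class (fixing end points) of curves without self-intersections, the end points possibly coinciding, which either join two marked points and are neither contractible nor isotopic to a boundary segment (finite arcs), or start at a marked point and spiral infinitely around the meridian, in one of the two directions (asymptotic arcs; their lifts tend to $-\infty$ or to $+\infty$ in the strip). Two arcs are compatible if they have representatives that do not intersect (except at common end points). A triangulation $T$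 of $A_{n,m}$ is a maximal collection of pairwise compatible arcs. Its preimage in the strip cuts out triangles, with vertices among the marked points and the two ends $\pm\infty$ of the strip. We say that $T$ realizes $(a_1,\dots,a_n)$ if, for $1\le k\le n$, exactly $a_k$ of these triangles are incident with $v_k$. **Corollary.** Let $\mathcal F=(m_{ij})$ be an infinite frieze of period $n\ge1$ with quiddity row $(a_i)_{i\in\mathbb Z}$, let $m\ge 0$, and let $T$ be a triangulation of $A_{n,m}$ realizing $(a_1,\dots,a_n)$. Then for all integers $i\le j$, the entry $m_{ij}$ is the (finite) number of matchings between the lower marked points $v_i,v_{i+1},\dots,v_j$ and the triangles of the lifted triangulation, that is, the number of ways to assign to each $v_k$ ($i\le k\le j$) a triangle incident with $v_k$ such that distinct points get distinct triangles. -/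

import Mathlib

/-- An infinite frieze of positive integers: an array `(m_{ij})` with `i, j ∈ ℤ` and `j ≥ i - 2`,
with a row of zeros, a row of ones, positive entries `m_{ij}` for `i ≤ j`, and the unimodular rule
for every diamond of the array. The values `entry i j` with `j < i - 2` are outside the array and
are not constrained. -/
structure InfiniteFrieze where
  entry : ℤ → ℤ → ℤ
  entry_zero : ∀ i, entry i (i - 2) = 0
  entry_one : ∀ i, entry i (i - 1) = 1
  entry_pos : ∀ i j, i ≤ j → 0 < entry i j
  unimodular : ∀ i j, i - 1 ≤ j →
    entry i j * entry (i + 1) (j + 1) - entry (i + 1) j * entry i (j + 1) = 1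

namespace InfiniteFrieze

/-- The quiddity row `a_i = m_{ii}`. -/
def quiddity (F : InfiniteFrieze) (i : ℤ) : ℤ := F.entry i i

/-- The frieze has period `n`: its quiddity row has period `n` (not necessarily the shortest). -/
def HasPeriod (F : InfiniteFrieze) (n : ℕ) : Prop :=
  ∀ i, F.quiddity (i + n) = F.quiddity i

end InfiniteFrieze

/-!
## The universal cover of the annulus

The annulus `A_{n,m}` has `n` marked points `1, …, n` on its outer boundary and `m` marked points
`n + 1, …, n + m` on its inner boundary. Its universal cover is a strip of height one.
-/

/-- The points at which lifts of arcs of the annulus to the strip may end: the marked points of the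
lower and of the upper boundary line, numbered from left to right, and the two ends `-∞`, `+∞` of
the strip. In coordinates, for `m > 0`, `lower k` is `((k - 1) m, 0)` and `upper k` is
`((k - 1) n, 1)`; for `m = 0`, `lower k` is `(k - 1, 0)`. So `lower k` lies over the outer marked
point `k` modulo `n`, and `upper k` lies over the inner marked point `n + (k mod m)`. -/
inductive StripPoint : Type
  | left : StripPoint
  | lower (k : ℤ) : StripPoint
  | right : StripPoint
  | upper (k : ℤ) : StripPoint

namespace StripPoint

/-- The place of a point on the boundary circle of the strip (compactified by its two ends), run
through counterclockwise from the left end: the left end, the lower line from left to right,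
the right end, the upper line from right to left. -/
def place : StripPoint → ℕ ×ₗ ℤ
  | left => toLex (0, 0)
  | lower k => toLex (1, k)
  | right => toLex (2, 0)
  | upper k => toLex (3, -k)

theorem place_injective : Function.Injective place := by
  intro p q h
  cases p <;> cases q <;> simp_all [place]

noncomputable instance : LinearOrder StripPoint := LinearOrder.lift' place place_injective

/-- The point is present in the cover of `A_{n,m}`: for `m = 0` there are no marked points on the
upper boundary. -/
def IsPresent (m : ℕ) : StripPoint → Prop
  | upper _ => 0 < m
  | _ => True

/-- The deck transformation number `t`: translation of the strip by `t` fundamental domains, each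
of which has `n` marked points below and `m` above. -/
def shift (n m : ℕ) (t : ℤ) : StripPoint → StripPoint
  | left => left
  | lower k => lower (k + t * n)
  | right => right
  | upper k => upper (k + t * m)

theorem shift_zero (n m : ℕ) : shift n m 0 = id := by
  funext p
  cases p <;> simp [shift]

theorem shift_comp (n m : ℕ) (s t : ℤ) : shift n m s ∘ shift n m t = shift n m (t + s) := by
  funext p
  cases p <;> simp [shift] <;> ring

end StripPoint

open StripPoint in
/-- The boundary segments of the strip: pairs of neighbouring marked points on one boundary. -/
def IsBoundarySegment (m : ℕ) (e : Sym2 StripPoint) : Prop :=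
  (∃ k, e = s(lower k, lower (k + 1))) ∨ (0 < m ∧ ∃ k, e = s(upper k, upper (k + 1)))

/-- Two curves of the strip given by their end points cross (have no representatives that are
disjoint away from common end points) if and only if their end points are linked on the boundary
circle of the strip. -/
def Crosses (e f : Sym2 StripPoint) : Prop :=
  ∃ a b c d : StripPoint, a < c ∧ c < b ∧ b < d ∧
    ((e = s(a, b) ∧ f = s(c, d)) ∨ (f = s(a, b) ∧ e = s(c, d)))

/-- The lifts to the strip of arcs of `A_{n,m}`. The strip is simply connected, so the
isotopy class of a curve in it is given by its (unordered) end points. A finite arc joins two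
marked points; it is peripheral if they are on the same boundary and bridging otherwise. An
asymptotic arc starts at a marked point and tends to `-∞` or `+∞`; in the annulus it spirals
around the meridian in one of the two directions. Contractible curves and boundary segments are
not arcs, nor is the curve from `-∞` to `+∞`, which covers the meridian. The last condition says
that the arc has no self-intersections in the annulus. -/
structure IsLiftedArc (n m : ℕ) (e : Sym2 StripPoint) : Prop where
  isPresent : ∀ p ∈ e, p.IsPresent m
  not_contractible : ¬ e.IsDiag
  not_meridian : e ≠ s(StripPoint.left, StripPoint.right)
  not_boundary : ¬ IsBoundarySegment m e
  simple : ∀ t : ℤ, ¬ Crosses e (e.map (StripPoint.shift n m t))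

/-- Two lifted arcs lie over the same arc of the annulus if a deck transformation takes one to the
other. -/
def deckSetoid (n m : ℕ) : Setoid {e : Sym2 StripPoint // IsLiftedArc n m e} where
  r e f := ∃ t : ℤ, e.1.map (StripPoint.shift n m t) = f.1
  iseqv :=
    { refl := fun e => ⟨0, by rw [StripPoint.shift_zero, Sym2.map_id, id]⟩
      symm := by
        rintro e f ⟨t, h⟩
        refine ⟨-t, ?_⟩
        rw [← h, Sym2.map_map, StripPoint.shift_comp, add_neg_cancel, StripPoint.shift_zero,
          Sym2.map_id, id]
      trans := by
        rintro e f g ⟨s, h⟩ ⟨t, h'⟩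
        exact ⟨s + t, by rw [← h', ← h, Sym2.map_map, StripPoint.shift_comp]⟩ }

/-- The arcs (isotopy classes) of the annulus `A_{n,m}`, finite and asymptotic ones. -/
def AnnulusArc (n m : ℕ) : Type := Quotient (deckSetoid n m)

namespace AnnulusArc

variable {n m : ℕ}

/-- The preimage in the strip of a set of arcs of the annulus. -/
def preimage (T : Set (AnnulusArc n m)) : Set (Sym2 StripPoint) :=
  {e | ∃ h : IsLiftedArc n m e, Quotient.mk (deckSetoid n m) ⟨e, h⟩ ∈ T}

/-- Two arcs of the annulus are compatible if no lift of the first crosses a lift of the second. -/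
def Compatible (α β : AnnulusArc n m) : Prop :=
  ∀ e ∈ preimage {α}, ∀ f ∈ preimage {β}, ¬ Crosses e f

/-- A triangulation of the annulus: a maximal collection of pairwise compatible arcs. -/
def IsTriangulation (T : Set (AnnulusArc n m)) : Prop :=
  Maximal (fun S : Set (AnnulusArc n m) => S.Pairwise Compatible) T

/-- A triangle of the lifted triangulation of the strip, given by its three vertices (marked points
or ends of the strip): any two of them are joined by a lifted arc or a boundary segment. As all
vertices lie on the boundary circle of the strip and as the arcs do not cross, no arc enters
the inside of such a triangle, so it is a region of the lifted triangulation. -/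
def IsTriangle (T : Set (AnnulusArc n m)) (t : Finset StripPoint) : Prop :=
  t.card = 3 ∧ ∀ p ∈ t, ∀ q ∈ t, p ≠ q → s(p, q) ∈ preimage T ∨ IsBoundarySegment m s(p, q)

/-- The number of triangles of the lifted triangulation incident with the lower marked point `k`.
The (outer) quiddity sequence of `T` consists of these numbers for `k = 1, …, n`. -/
noncomputable def quiddity (T : Set (AnnulusArc n m)) (k : ℤ) : ℕ :=
  {t : Finset StripPoint | IsTriangle T t ∧ StripPoint.lower k ∈ t}.ncard

/-- `T` realizes the quiddity sequence `(a_1, …, a_n)` of the frieze. -/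
def Realizes (T : Set (AnnulusArc n m)) (F : InfiniteFrieze) : Prop :=
  ∀ k : ℤ, 1 ≤ k → k ≤ n → (quiddity T k : ℤ) = F.quiddity k

/-- The matchings between the lower marked points `i, i + 1, …, j` and the triangles of the lifted
triangulation: each of the points is matched with a triangle incident with it, and different points
are matched with different triangles. -/
def matchings (T : Set (AnnulusArc n m)) (i j : ℤ) :
    Set (Finset.Icc i j → Finset StripPoint) :=
  {f | Function.Injective f ∧
    ∀ k : Finset.Icc i j, IsTriangle T (f k) ∧ StripPoint.lower (k : ℤ) ∈ f k}

end AnnulusArc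

/-!
For fixed `i`, both the entries `m_{i,j-1}` and the numbers `M_j` of matchings of `v_i, …, v_{j-1}`
satisfy a recursion of the form `x_{j+1} = a_j x_j - x_{j-1}`, with the same initial values. For the
entries it follows from the unimodular rule. For the matchings, the points beneath a side of the
triangulation use up the triangles beneath it in exactly one way, so the points beneath the leftmost
side `(k, j)` at `v_j` with `i ≤ k` may be removed together with these triangles. Of the remaining
triangles at `v_j` only the one above this side competes with the earlier points: it is used at
`v_k` by `M_k` of the matchings counted by `M_j`. Hence `M_{j+1} = (a_j - b) M_j - M_k`, where `b`
is the number of triangles at `v_j` beneath the side. Splitting off these `b` triangles one by one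
gives `M_{j-1} = M_k + b M_j`, and the recursion follows.

Geometrically one needs exactly one triangle above each side between lower points. If further sides
pass over it, the lowest of them gives its third vertex; otherwise its ends can be reached from the
upper side, and the third vertex is an end of the strip or an upper point, by maximality of the
triangulation and translation of arcs.
-/

theorem InfiniteFrieze.entry_eq_mul_sub (F : InfiniteFrieze) {i j : ℤ} (hij : i ≤ j) :
    F.entry i j = F.quiddity j * F.entry i (j - 1) - F.entry i (j - 2) := by
  induction i, hij using Int.leInductionDown with
  | base => simp only [F.entry_one, F.entry_zero, quiddity, mul_one, sub_zero]
  | pred i hij ih =>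
    have hdiamond := F.unimodular (i - 1) (j - 1) (by omega)
    have hdiamond' := F.unimodular (i - 1) (j - 2) (by omega)
    have hne : F.entry i (j - 1) ≠ 0 := by
      rcases hij.eq_or_lt with rfl | hlt
      · simp only [F.entry_one, ne_eq, one_ne_zero, not_false_eq_true]
      · exact (F.entry_pos _ _ (by omega)).ne'
    rw [sub_add_cancel, sub_add_cancel, ih] at hdiamond
    rw [sub_add_cancel, show j - 2 + 1 = j - 1 by ring] at hdiamond'
    apply mul_left_cancel₀ hne
    linear_combination hdiamond' - hdiamond

section Matchings

open Finset

variable {ι α : Type*} {t t' : ι → Finset α} {s : Finset ι}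

/-- The number of matchings of the points of `s` with elements of their respective sets `t k`. -/
noncomputable def matchingCount (t : ι → Finset α) (s : Finset ι) : ℕ :=
  Nat.card (hallMatchingsOn t s)

theorem matchingCount_congr (h : ∀ k ∈ s, t k = t' k) : matchingCount t s = matchingCount t' s := by
  have : hallMatchingsOn t s = hallMatchingsOn t' s := by
    ext f
    exact and_congr_right' (forall_congr' fun k => by rw [h k k.2])
  rw [matchingCount, matchingCount, this]

theorem matchingCount_empty (t : ι → Finset α) : matchingCount t ∅ = 1 := by
  have : Unique (hallMatchingsOn t ∅) :=
    { default := ⟨isEmptyElim, Function.injective_of_subsingleton _, isEmptyElim⟩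
      uniq := fun _ => Subtype.ext (Subsingleton.elim _ _) }
  exact Nat.card_unique

variable [DecidableEq α]

theorem matchingCount_sdiff {U : Finset α} (h : ∀ k ∈ s, Disjoint (t k) U) :
    matchingCount (fun k => t k \ U) s = matchingCount t s :=
  matchingCount_congr fun k hk => sdiff_eq_self_of_disjoint (h k hk)

variable [DecidableEq ι]

theorem matchingCount_insert {a : ι} (ha : a ∉ s) :
    matchingCount t (insert a s) = ∑ x ∈ t a, matchingCount (fun k => t k \ {x}) s := by
  have ne_a (k : s) : k.1 ≠ a := ne_of_mem_of_not_mem k.2 ha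
  let removePoint (f : hallMatchingsOn t (insert a s)) :
      Σ x : t a, hallMatchingsOn (fun k => t k \ {x.1}) s :=
    ⟨⟨f.1 ⟨a, mem_insert_self a s⟩, f.2.2 _⟩, fun k => f.1 ⟨k, mem_insert_of_mem k.2⟩,
      fun k l hkl => Subtype.ext (congrArg Subtype.val (f.2.1 hkl) :),
      fun k => mem_sdiff.2 ⟨f.2.2 _, fun h => ne_a k
        (congrArg Subtype.val (f.2.1 (mem_singleton.1 h)) :)⟩⟩
  let addPoint (g : Σ x : t a, hallMatchingsOn (fun k => t k \ {x.1}) s) :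
      hallMatchingsOn t (insert a s) :=
    ⟨fun k => if h : k.1 = a then g.1 else g.2.1 ⟨k, mem_of_mem_insert_of_ne k.2 h⟩, by
      have hinj := @g.2.2.1
      have hmem k := mem_sdiff.1 (g.2.2.2 k)
      exact ⟨fun k l hkl => by grind, fun k => by grind⟩⟩
  have e : hallMatchingsOn t (insert a s) ≃ Σ x : t a, hallMatchingsOn (fun k => t k \ {x.1}) s :=
    { toFun := removePoint
      invFun := addPoint
      left_inv := fun f => by
        ext k
        by_cases h : k.1 = a <;> grind
      right_inv := fun g =>
        Sigma.subtype_ext (Subtype.ext (dif_pos rfl)) (funext fun k => dif_neg (ne_a k)) }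
  rw [← sum_coe_sort (t a), matchingCount, Nat.card_congr e, Nat.card_sigma]
  rfl

end Matchings

section FanCombinatorics

open Finset

variable {τ : Type*}

/-- The points `k < l` are the ends of an edge of a triangulation with fans `fan`: some triangle
has both as vertices. -/
def FanEdge (fan : ℤ → Finset τ) (k l : ℤ) : Prop := k < l ∧ ∃ t ∈ fan k, t ∈ fan l

/-- The triangle `t` has the vertices `p < q < r` on the line. -/
structure IsPeripheralTriangle (fan : ℤ → Finset τ) (t : τ) (p q r : ℤ) : Prop where
  left_lt : p < q
  lt_right : q < r
  mem_left : t ∈ fan p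
  mem_mid : t ∈ fan q
  mem_right : t ∈ fan r

variable {fan : ℤ → Finset τ} {i j k l p q r : ℤ} {t u : τ}

namespace IsPeripheralTriangle

theorem left_edge (ht : IsPeripheralTriangle fan t p q r) : FanEdge fan p q :=
  ⟨ht.left_lt, t, ht.mem_left, ht.mem_mid⟩

theorem right_edge (ht : IsPeripheralTriangle fan t p q r) : FanEdge fan q r :=
  ⟨ht.lt_right, t, ht.mem_mid, ht.mem_right⟩

theorem outer_edge (ht : IsPeripheralTriangle fan t p q r) : FanEdge fan p r :=
  ⟨ht.left_lt.trans ht.lt_right, t, ht.mem_left, ht.mem_right⟩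

end IsPeripheralTriangle

variable [DecidableEq τ]

/-- The triangles incident with a point strictly between `k` and `l`. If `k` and `l` are the ends
of an edge, these are the triangles cut off by that edge. -/
noncomputable def beneath (fan : ℤ → Finset τ) (k l : ℤ) : Finset τ := (Ioo k l).biUnion fan

/-- The incidences between the points `k ∈ ℤ` of a line and the triangles of a triangulation of a
region above the line: `fan k` is the set of triangles with vertex `k`. -/
structure IsFanSystem (fan : ℤ → Finset τ) : Prop where
  exists_consecutive : ∀ k, ∃ t ∈ fan k, t ∈ fan (k + 1)
  mem_Icc : ∀ {k l q r : ℤ} {t u : τ}, t ∈ fan k → t ∈ fan l → u ∈ fan q → u ∈ fan r →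
    q ∈ Ioo k l → r ∈ Icc k l
  exists_peripheral : ∀ {k l : ℤ}, FanEdge fan k l → k + 1 < l →
    ∃ t q, IsPeripheralTriangle fan t k q l
  exists_ne : ∀ {k l q : ℤ} {t u : τ}, IsPeripheralTriangle fan t k q l → u ∈ fan q → u ≠ t →
    ∃ r ∈ Ioo k l, r ≠ q ∧ u ∈ fan r
  existsUnique_above : ∀ {k l : ℤ}, FanEdge fan k l →
    ∃! t, t ∈ fan k ∧ t ∈ fan l ∧ t ∉ beneath fan k l

theorem mem_beneath : t ∈ beneath fan k l ↔ ∃ q ∈ Ioo k l, t ∈ fan q := mem_biUnion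

theorem beneath_succ : beneath fan k (k + 1) = ∅ := by
  rw [beneath, Ioo_add_one_right_eq_Ioc, Ioc_self, biUnion_empty]

namespace IsPeripheralTriangle

theorem eq_of_mem (ht : IsPeripheralTriangle fan t p q r) (h : IsFanSystem fan) {s : ℤ}
    (hs : t ∈ fan s) : s = p ∨ s = q ∨ s = r := by
  have := ht.left_lt
  have := ht.lt_right
  have hpr := h.mem_Icc ht.mem_left ht.mem_right ht.mem_mid hs
  have hpq := h.mem_Icc ht.mem_left ht.mem_mid hs ht.mem_right
  have hqr := h.mem_Icc ht.mem_mid ht.mem_right hs ht.mem_left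
  simp only [mem_Ioo, mem_Icc] at hpr hpq hqr
  omega

end IsPeripheralTriangle

namespace IsFanSystem

theorem notMem_beneath_of_notMem_Icc (h : IsFanSystem fan) (he : FanEdge fan k l) (hu : u ∈ fan q)
    (hq : q ∉ Icc k l) : u ∉ beneath fan k l := by
  rw [mem_beneath]
  rintro ⟨s, hs, hus⟩
  obtain ⟨-, t, htk, htl⟩ := he
  exact hq (h.mem_Icc htk htl hus hu hs)

theorem edge_induction (h : IsFanSystem fan) {motive : ∀ k l, FanEdge fan k l → Prop}
    (consecutive : ∀ k he, motive k (k + 1) he)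
    (peripheral : ∀ t p q r (ht : IsPeripheralTriangle fan t p q r), motive p q ht.left_edge →
      motive q r ht.right_edge → motive p r ht.outer_edge)
    {k l : ℤ} (he : FanEdge fan k l) : motive k l he := by
  induction hd : (l - k).toNat using Nat.strong_induction_on generalizing k l with
  | _ d ih =>
    rcases (Int.add_one_le_of_lt he.1).eq_or_lt with rfl | hlt
    · exact consecutive k he
    · obtain ⟨t, q, ht⟩ := h.exists_peripheral he hlt
      have := ht.left_lt
      have := ht.lt_right
      exact peripheral t k q l ht (ih _ (by omega) ht.left_edge rfl)
        (ih _ (by omega) ht.right_edge rfl)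

theorem beneath_eq_insert (h : IsFanSystem fan) (ht : IsPeripheralTriangle fan t p q r) :
    beneath fan p r = insert t (beneath fan p q ∪ beneath fan q r) := by
  have hpq := ht.left_lt
  have hqr := ht.lt_right
  ext u
  simp only [mem_insert, mem_union, mem_beneath, mem_Ioo]
  constructor
  · rintro ⟨s, hs, hu⟩
    rcases eq_or_ne u t with rfl | hut
    · exact Or.inl rfl
    · obtain ⟨s, hs, hsq, hu⟩ : ∃ s, (p < s ∧ s < r) ∧ s ≠ q ∧ u ∈ fan s := by
        by_cases hsq : s = q
        · simpa only [mem_Ioo] using h.exists_ne ht (hsq ▸ hu) hut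
        · exact ⟨s, hs, hsq, hu⟩
      rcases hsq.lt_or_gt with hsq | hsq
      · exact Or.inr (Or.inl ⟨s, ⟨hs.1, hsq⟩, hu⟩)
      · exact Or.inr (Or.inr ⟨s, ⟨hsq, hs.2⟩, hu⟩)
  · rintro (rfl | ⟨s, hs, hu⟩ | ⟨s, hs, hu⟩)
    · exact ⟨q, ⟨hpq, hqr⟩, ht.mem_mid⟩
    · exact ⟨s, ⟨hs.1, hs.2.trans hqr⟩, hu⟩
    · exact ⟨s, ⟨hpq.trans hs.1, hs.2⟩, hu⟩

theorem sdiff_beneath_mid (h : IsFanSystem fan) (ht : IsPeripheralTriangle fan t p q r) :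
    (fan q \ beneath fan p q) \ beneath fan q r = {t} := by
  ext u
  simp only [mem_sdiff, mem_singleton, mem_beneath, mem_Ioo]
  refine ⟨fun ⟨⟨hu, hpq⟩, hqr⟩ => ?_, ?_⟩
  · by_contra hut
    obtain ⟨s, hs, hsq, hus⟩ := h.exists_ne ht hu hut
    rw [mem_Ioo] at hs
    rcases hsq.lt_or_gt with hsq | hsq
    · exact hpq ⟨s, ⟨hs.1, hsq⟩, hus⟩
    · exact hqr ⟨s, ⟨hsq, hs.2⟩, hus⟩
  · rintro rfl
    have := ht.left_lt
    have := ht.lt_right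
    refine ⟨⟨ht.mem_mid, ?_⟩, ?_⟩ <;>
    · rintro ⟨s, hs, hus⟩
      have := ht.eq_of_mem h hus
      omega

theorem matchingCount_Ioo_union (h : IsFanSystem fan) (he : FanEdge fan k l) {g : ℤ → Finset τ}
    {R : Finset ℤ} (hg : ∀ s ∈ Ioo k l, g s = fan s) (hR : Disjoint (Ioo k l) R) :
    matchingCount g (Ioo k l ∪ R) = matchingCount (fun s => g s \ beneath fan k l) R := by
  induction he using h.edge_induction generalizing g R with
  | consecutive k _ =>
    simp only [Ioo_add_one_right_eq_Ioc, Ioc_self, empty_union, beneath_succ, sdiff_empty]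
  | peripheral t p q r ht ih_left ih_right =>
    have hpq := ht.left_lt
    have hqr := ht.lt_right
    simp only [disjoint_left, mem_Ioo] at hg hR ih_left ih_right
    have hpqr : Ioo p r ∪ R = Ioo p q ∪ (Ioo q r ∪ insert q R) := by
      ext s
      simp only [mem_union, mem_insert, mem_Ioo]
      grind
    have hg' (s) (hs : q < s ∧ s < r) : g s \ beneath fan p q = fan s := by
      rw [hg s ⟨hpq.trans hs.1, hs.2⟩]
      refine sdiff_eq_self_of_disjoint (disjoint_left.2 fun u hu => ?_)
      refine h.notMem_beneath_of_notMem_Icc ht.left_edge hu ?_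
      simp [hs.1]
    have hmid : (g q \ beneath fan p q) \ beneath fan q r = {t} := by
      rw [hg q ⟨hpq, hqr⟩, h.sdiff_beneath_mid ht]
    rw [hpqr, ih_left (fun s hs => hg s (by grind)) (by grind), ih_right hg' (by grind),
      matchingCount_insert (by grind), hmid, sum_singleton]
    refine matchingCount_congr fun s _ => ?_
    rw [h.beneath_eq_insert ht]
    grind

theorem disjoint_beneath (h : IsFanSystem fan) (he : FanEdge fan k l) (hq : q ∉ Icc k l) :
    Disjoint (fan q) (beneath fan k l) :=
  disjoint_left.2 fun _ hu => h.notMem_beneath_of_notMem_Icc he hu hq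

theorem matchingCount_Ico_eq_sum (h : IsFanSystem fan) (he : FanEdge fan k l) (hik : i ≤ k)
    {g : ℤ → Finset τ} (hg : ∀ s ∈ Ico i l, s ≠ k → g s = fan s) :
    matchingCount g (Ico i l) =
      ∑ t ∈ g k \ beneath fan k l, matchingCount (fun s => fan s \ {t}) (Ico i k) := by
  have hkl := he.1
  have hsplit : Ico i l = Ioo k l ∪ insert k (Ico i k) := by
    ext
    simp only [mem_union, mem_insert, mem_Ico, mem_Ioo]
    omega
  have hdisj : Disjoint (Ioo k l) (insert k (Ico i k)) :=
    disjoint_left.2 fun s => by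
      simp only [mem_insert, mem_Ico, mem_Ioo]
      omega
  have hleft (s) (hs : s ∈ Ico i k) : g s \ beneath fan k l = fan s := by
    rw [mem_Ico] at hs
    rw [hg s (mem_Ico.2 ⟨hs.1, hs.2.trans hkl⟩) hs.2.ne, sdiff_eq_self_of_disjoint]
    exact h.disjoint_beneath he (by simp [hs.2])
  have hIoo (s) (hs : s ∈ Ioo k l) : g s = fan s := by
    rw [mem_Ioo] at hs
    exact hg s (mem_Ico.2 ⟨hik.trans hs.1.le, hs.2⟩) hs.1.ne'
  rw [hsplit, h.matchingCount_Ioo_union he hIoo hdisj, matchingCount_insert (by simp)]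
  exact sum_congr rfl fun t _ => matchingCount_congr fun s hs => by rw [hleft s hs]

theorem matchingCount_Ico_succ (h : IsFanSystem fan) (he : FanEdge fan k l) (hik : i ≤ k) :
    matchingCount fan (Ico i (l + 1)) =
      ∑ t ∈ fan l \ beneath fan k l, matchingCount (fun s => fan s \ {t}) (Ico i l) := by
  have hkl := he.1
  have hsplit : Ico i l = Ioo k l ∪ Ico i (k + 1) := by
    ext
    simp only [mem_union, mem_Ico, mem_Ioo]
    omega
  have hdisj : Disjoint (Ioo k l) (Ico i (k + 1)) :=
    disjoint_left.2 fun s => by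
      simp only [mem_Ico, mem_Ioo]
      omega
  have hdisj' : Disjoint (Ioo k l) (insert l (Ico i (k + 1))) :=
    disjoint_insert_right.2 ⟨by simp, hdisj⟩
  have hl : l ∉ Ico i (k + 1) := by
    rw [mem_Ico]
    omega
  rw [Ico_add_one_right_eq_Icc, ← Ico_insert_right (hik.trans hkl.le), hsplit, ← union_insert,
    h.matchingCount_Ioo_union he (fun _ _ => rfl) hdisj', matchingCount_insert hl]
  refine sum_congr rfl fun t ht => ?_
  have hIoo (s) (hs : s ∈ Ioo k l) : fan s \ {t} = fan s :=
    sdiff_eq_self_of_disjoint <| disjoint_singleton_right.2 fun hts =>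
      (mem_sdiff.1 ht).2 (mem_beneath.2 ⟨s, hs, hts⟩)
  rw [h.matchingCount_Ioo_union he hIoo hdisj]
  simp only [sdiff_right_comm]

theorem matchingCount_Ico_mid (h : IsFanSystem fan) (ht : IsPeripheralTriangle fan t p q r)
    (hip : i ≤ p) :
    matchingCount fan (Ico i q) = matchingCount fan (Ico i p) + matchingCount fan (Ico i r) := by
  have hpq := ht.left_lt
  have hqr := ht.lt_right
  have ht_notMem : t ∉ beneath fan p q := fun hmem => by
    obtain ⟨s, hs, hts⟩ := mem_beneath.1 hmem
    rw [mem_Ioo] at hs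
    have := ht.eq_of_mem h hts
    omega
  have hright := h.disjoint_beneath ht.right_edge (q := p) (by simp [hpq])
  have hinsert : fan p \ beneath fan p q = insert t (fan p \ beneath fan p r) := by
    have := ht.mem_left
    rw [h.beneath_eq_insert ht]
    grind [disjoint_left]
  have ht_outer : t ∉ fan p \ beneath fan p r := by
    simp [h.beneath_eq_insert ht]
  have hleft (s) (hs : s ∈ Ico i p) : Disjoint (fan s) {t} :=
    disjoint_singleton_right.2 fun hts => by
      rw [mem_Ico] at hs
      have := ht.eq_of_mem h hts
      omega
  rw [h.matchingCount_Ico_eq_sum ht.left_edge hip fun _ _ _ => rfl, hinsert, sum_insert ht_outer,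
    ← h.matchingCount_Ico_eq_sum ht.outer_edge hip fun _ _ _ => rfl, matchingCount_sdiff hleft]

theorem matchingCount_Ico_pred (h : IsFanSystem fan) (he : FanEdge fan k l) (hik : i ≤ k) :
    matchingCount fan (Ico i (l - 1)) = matchingCount fan (Ico i k) +
      (fan l ∩ beneath fan k l).card * matchingCount fan (Ico i l) := by
  induction he using h.edge_induction with
  | consecutive k _ =>
    rw [beneath_succ, inter_empty, card_empty, zero_mul, add_zero, add_sub_cancel_right]
  | peripheral t p q r ht _ ih =>
    have hpq := ht.left_lt
    have hqr := ht.lt_right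
    have hleft := h.disjoint_beneath ht.left_edge (q := r) (by simp [hqr])
    have hinsert : fan r ∩ beneath fan p r = insert t (fan r ∩ beneath fan q r) := by
      have := ht.mem_right
      rw [h.beneath_eq_insert ht]
      grind [disjoint_left]
    have ht_notMem : t ∉ fan r ∩ beneath fan q r := fun hmem => by
      obtain ⟨s, hs, hts⟩ := mem_beneath.1 (mem_inter.1 hmem).2
      rw [mem_Ioo] at hs
      have := ht.eq_of_mem h hts
      omega
    rw [ih (hik.trans hpq.le), h.matchingCount_Ico_mid ht hik, hinsert,
      card_insert_of_notMem ht_notMem]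
    ring

theorem exists_leftmost_edge (h : IsFanSystem fan) (hij : i < j) :
    ∃ k, i ≤ k ∧ FanEdge fan k j ∧ ∀ s ∈ Ico i k, ¬ FanEdge fan s j := by
  have hlast : FanEdge fan (j - 1) j := by
    obtain ⟨t, ht, ht'⟩ := h.exists_consecutive (j - 1)
    exact ⟨sub_one_lt j, t, ht, by rwa [sub_add_cancel] at ht'⟩
  obtain ⟨k, ⟨hik, he⟩, hmin⟩ := Int.exists_least_of_bdd (P := fun k => i ≤ k ∧ FanEdge fan k j)
    ⟨i, fun _ hk => hk.1⟩ ⟨j - 1, Int.le_sub_one_of_lt hij, hlast⟩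
  refine ⟨k, hik, he, fun s hs hes => ?_⟩
  rw [mem_Ico] at hs
  exact hs.2.not_ge (hmin s ⟨hs.1, hes⟩)

theorem eq_of_mem_of_leftmost (hleftmost : ∀ s ∈ Ico i k, ¬ FanEdge fan s j)
    (ht : t ∈ fan j \ beneath fan k j) {s : ℤ} (hs : s ∈ Ico i j) (hts : t ∈ fan s) : s = k := by
  rw [mem_Ico] at hs
  rw [mem_sdiff, mem_beneath] at ht
  by_contra hsk
  rcases lt_or_gt_of_ne hsk with hlt | hgt
  · exact hleftmost s (mem_Ico.2 ⟨hs.1, hlt⟩) ⟨hs.2, t, hts, ht.1⟩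
  · exact ht.2 ⟨s, mem_Ioo.2 ⟨hgt, hs.2⟩, hts⟩

/-- Among the triangles available at `j`, the only one that the points from `i` to `j - 1` could
also use is the triangle above the leftmost edge at `j`. -/
theorem matchingCount_Ico_succ_add (h : IsFanSystem fan) (he : FanEdge fan k j) (hik : i ≤ k)
    (hleftmost : ∀ s ∈ Ico i k, ¬ FanEdge fan s j) :
    matchingCount fan (Ico i (j + 1)) + matchingCount fan (Ico i k) =
      (fan j \ beneath fan k j).card * matchingCount fan (Ico i j) := by
  obtain ⟨t₀, ⟨htk, htj, ht_beneath⟩, ht_unique⟩ := h.existsUnique_above he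
  have eq_k_of_mem {t} := eq_of_mem_of_leftmost hleftmost (t := t)
  have ht₀ : t₀ ∈ fan j \ beneath fan k j := mem_sdiff.2 ⟨htj, ht_beneath⟩
  have count_above : matchingCount fan (Ico i j) = matchingCount fan (Ico i k) +
      matchingCount (fun s => fan s \ {t₀}) (Ico i j) := by
    have hoff (s) (hs : s ∈ Ico i j) (hsk : s ≠ k) : Disjoint (fan s) {t₀} :=
      disjoint_singleton_right.2 fun hts => hsk (eq_k_of_mem ht₀ hs hts)
    have hleft (s) (hs : s ∈ Ico i k) : Disjoint (fan s) {t₀} := by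
      rw [mem_Ico] at hs
      exact hoff s (mem_Ico.2 ⟨hs.1, hs.2.trans he.1⟩) hs.2.ne
    rw [h.matchingCount_Ico_eq_sum he hik fun s hs hsk => sdiff_eq_self_of_disjoint (hoff s hs hsk),
      h.matchingCount_Ico_eq_sum he hik fun _ _ _ => rfl, ← matchingCount_sdiff hleft,
      sdiff_right_comm, sdiff_singleton_eq_erase]
    exact (add_sum_erase _ (fun t => matchingCount (fun s => fan s \ {t}) (Ico i k))
      (mem_sdiff.2 ⟨htk, ht_beneath⟩)).symm
  have count_other (t) (ht : t ∈ (fan j \ beneath fan k j).erase t₀) :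
      matchingCount (fun s => fan s \ {t}) (Ico i j) = matchingCount fan (Ico i j) := by
    refine matchingCount_sdiff fun s hs => disjoint_singleton_right.2 fun hts => ?_
    obtain ⟨hne, ht⟩ := mem_erase.1 ht
    have hsk := eq_k_of_mem ht hs hts
    exact hne (ht_unique t ⟨hsk ▸ hts, (mem_sdiff.1 ht).1, (mem_sdiff.1 ht).2⟩)
  rw [h.matchingCount_Ico_succ he hik, ← add_sum_erase _ _ ht₀, sum_congr rfl count_other,
    sum_const, smul_eq_mul, ← card_erase_add_one ht₀, add_one_mul]
  omega

theorem matchingCount_Ico_succ_add_pred (h : IsFanSystem fan) (hij : i < j) :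
    matchingCount fan (Ico i (j + 1)) + matchingCount fan (Ico i (j - 1)) =
      (fan j).card * matchingCount fan (Ico i j) := by
  obtain ⟨k, hik, he, hleftmost⟩ := h.exists_leftmost_edge hij
  rw [h.matchingCount_Ico_pred he hik, ← add_assoc, h.matchingCount_Ico_succ_add he hik hleftmost,
    ← add_mul, card_sdiff_add_card_inter]

theorem matchingCount_Icc_eq_entry (h : IsFanSystem fan) (F : InfiniteFrieze)
    (hF : ∀ k, ((fan k).card : ℤ) = F.quiddity k) (hij : i ≤ j) :
    (matchingCount fan (Icc i j) : ℤ) = F.entry i j := by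
  suffices H : ∀ j, i ≤ j → (matchingCount fan (Ico i j) : ℤ) = F.entry i (j - 1) ∧
      (matchingCount fan (Ico i (j + 1)) : ℤ) = F.entry i j by
    rw [← Ico_add_one_right_eq_Icc]
    exact (H j hij).2
  intro j hij
  induction j, hij using Int.leInduction with
  | base =>
    rw [Ico_add_one_right_eq_Icc, Icc_self, Ico_self, matchingCount_empty, F.entry_one,
      ← insert_empty_eq, matchingCount_insert (notMem_empty i)]
    simp [matchingCount_empty, hF, InfiniteFrieze.quiddity]
  | succ j hij ih =>
    rw [add_sub_cancel_right]
    refine ⟨ih.2, ?_⟩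
    have hrec := congrArg (Nat.cast (R := ℤ)) (h.matchingCount_Ico_succ_add_pred (i := i)
      (j := j + 1) (by omega))
    push_cast at hrec
    rw [add_sub_cancel_right, ih.1, ih.2, hF] at hrec
    rw [F.entry_eq_mul_sub (by omega), add_sub_cancel_right, show j + 1 - 2 = j - 1 by ring]
    exact eq_sub_of_add_eq hrec

end IsFanSystem

end FanCombinatorics

namespace StripPoint

variable {n m : ℕ}

theorem lt_iff_place_lt {p q : StripPoint} : p < q ↔ p.place < q.place := Iff.rfl

@[simp] theorem lower_lt_lower {k l : ℤ} : lower k < lower l ↔ k < l := by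
  simp [lt_iff_place_lt, place, Prod.Lex.toLex_lt_toLex]

@[simp] theorem upper_lt_upper {k l : ℤ} : upper k < upper l ↔ l < k := by
  simp [lt_iff_place_lt, place, Prod.Lex.toLex_lt_toLex]

@[simp] theorem left_lt_lower {k : ℤ} : left < lower k := by
  simp [lt_iff_place_lt, place, Prod.Lex.toLex_lt_toLex]

@[simp] theorem left_lt_right : left < right := by
  simp [lt_iff_place_lt, place, Prod.Lex.toLex_lt_toLex]

@[simp] theorem left_lt_upper {k : ℤ} : left < upper k := by
  simp [lt_iff_place_lt, place, Prod.Lex.toLex_lt_toLex]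

@[simp] theorem lower_lt_right {k : ℤ} : lower k < right := by
  simp [lt_iff_place_lt, place, Prod.Lex.toLex_lt_toLex]

@[simp] theorem lower_lt_upper {k l : ℤ} : lower k < upper l := by
  simp [lt_iff_place_lt, place, Prod.Lex.toLex_lt_toLex]

@[simp] theorem right_lt_upper {k : ℤ} : right < upper k := by
  simp [lt_iff_place_lt, place, Prod.Lex.toLex_lt_toLex]

@[simp] theorem lower_le_lower {k l : ℤ} : lower k ≤ lower l ↔ k ≤ l := by
  rw [← not_lt, lower_lt_lower, not_lt]

@[simp] theorem upper_le_upper {k l : ℤ} : upper k ≤ upper l ↔ l ≤ k := by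
  rw [← not_lt, upper_lt_upper, not_lt]

@[simp] theorem left_le (p : StripPoint) : left ≤ p := by
  cases p <;> simp [left_lt_lower.le, left_lt_right.le, left_lt_upper.le]

@[simp] theorem not_right_le_lower {k : ℤ} : ¬ right ≤ lower k := lower_lt_right.not_ge

@[simp] theorem not_upper_le_lower {k l : ℤ} : ¬ upper l ≤ lower k := lower_lt_upper.not_ge

@[simp] theorem not_lower_le_left {k : ℤ} : ¬ lower k ≤ left := left_lt_lower.not_ge

theorem exists_eq_lower {p : StripPoint} (hleft : left < p) (hright : p < right) :
    ∃ k, p = lower k := by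
  cases p <;> simp_all [not_lt_of_gt]

theorem exists_eq_lower_of_mem_Icc {k l : ℤ} {p : StripPoint}
    (hp : p ∈ Set.Icc (lower k) (lower l)) : ∃ q ∈ Set.Icc k l, p = lower q := by
  cases p <;> simp_all

theorem shift_strictMono (t : ℤ) : StrictMono (shift n m t) := by
  intro p q h
  cases p <;> cases q <;> simp_all [shift, not_lt_of_gt]

theorem IsPresent.shift {p : StripPoint} (h : p.IsPresent m) (t : ℤ) :
    (p.shift n m t).IsPresent m := by
  cases p <;> simp_all [StripPoint.shift, IsPresent]

theorem map_shift_neg_map_shift (t : ℤ) (e : Sym2 StripPoint) :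
    (e.map (shift n m t)).map (shift n m (-t)) = e := by
  rw [Sym2.map_map, shift_comp, add_neg_cancel, shift_zero, Sym2.map_id, id]

theorem map_shift_comm (s t : ℤ) (e : Sym2 StripPoint) :
    (e.map (shift n m t)).map (shift n m s) = (e.map (shift n m s)).map (shift n m t) := by
  rw [Sym2.map_map, Sym2.map_map, shift_comp, shift_comp, add_comm]

end StripPoint

open StripPoint

section Crossings

open Set

variable {n m : ℕ} {e f : Sym2 StripPoint}

theorem crosses_mk_iff {a b c d : StripPoint} (hab : a < b) :
    Crosses s(a, b) s(c, d) ↔ c ∈ Ioo a b ∧ d ∉ Icc a b ∨ d ∈ Ioo a b ∧ c ∉ Icc a b := by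
  constructor
  · rintro ⟨a', b', c', d', hac, hcb, hbd, h⟩
    simp only [Sym2.eq_iff] at h
    simp only [mem_Ioo, mem_Icc]
    grind
  · simp only [mem_Ioo, mem_Icc, not_and_or, not_le]
    rintro (⟨⟨hac, hcb⟩, hda | hbd⟩ | ⟨⟨had, hdb⟩, hca | hbc⟩)
    · exact ⟨d, c, a, b, hda, hac, hcb, Or.inr ⟨Sym2.eq_swap, rfl⟩⟩
    · exact ⟨a, b, c, d, hac, hcb, hbd, Or.inl ⟨rfl, rfl⟩⟩
    · exact ⟨c, d, a, b, hca, had, hdb, Or.inr ⟨rfl, rfl⟩⟩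
    · exact ⟨a, b, d, c, had, hdb, hbc, Or.inl ⟨rfl, Sym2.eq_swap⟩⟩

theorem Crosses.symm (h : Crosses e f) : Crosses f e := by
  obtain ⟨a, b, c, d, hac, hcb, hbd, h⟩ := h
  exact ⟨a, b, c, d, hac, hcb, hbd, h.symm⟩

theorem Crosses.map_shift (h : Crosses e f) (t : ℤ) :
    Crosses (e.map (shift n m t)) (f.map (shift n m t)) := by
  have hmono := shift_strictMono (n := n) (m := m) t
  obtain ⟨a, b, c, d, hac, hcb, hbd, h⟩ := h
  refine ⟨_, _, _, _, hmono hac, hmono hcb, hmono hbd, ?_⟩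
  rcases h with ⟨rfl, rfl⟩ | ⟨rfl, rfl⟩
  · exact Or.inl ⟨rfl, rfl⟩
  · exact Or.inr ⟨rfl, rfl⟩

theorem IsBoundarySegment.map_shift (h : IsBoundarySegment m e) (t : ℤ) :
    IsBoundarySegment m (e.map (shift n m t)) := by
  rcases h with ⟨k, rfl⟩ | ⟨hm, k, rfl⟩
  · exact Or.inl ⟨k + t * n, by simp [shift, add_right_comm]⟩
  · exact Or.inr ⟨hm, k + t * m, by simp [shift, add_right_comm]⟩

theorem IsBoundarySegment.not_crosses (h : IsBoundarySegment m e) : ¬ Crosses e f := by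
  induction f with | _ c d
  rcases h with ⟨k, rfl⟩ | ⟨-, k, rfl⟩
  · have hIoo : Ioo (lower k) (lower (k + 1)) = ∅ := by
      ext p
      cases p <;> simp [not_lt_of_gt]
    simp [crosses_mk_iff, hIoo]
  · have hIoo : Ioo (upper (k + 1)) (upper k) = ∅ := by
      ext p
      cases p <;> simp [not_lt_of_gt]
    simp [Sym2.eq_swap (a := upper k), crosses_mk_iff, hIoo]

theorem isBoundarySegment_lower {k l : ℤ} (h : k < l) :
    IsBoundarySegment m s(lower k, lower l) ↔ l = k + 1 := by
  constructor
  · rintro (⟨a, ha⟩ | ⟨-, a, ha⟩)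
    · simp only [Sym2.eq_iff, lower.injEq] at ha
      omega
    · simp at ha
  · rintro rfl
    exact Or.inl ⟨k, rfl⟩

end Crossings

namespace IsLiftedArc

variable {n m : ℕ}

theorem map_shift {e : Sym2 StripPoint} (h : IsLiftedArc n m e) (t : ℤ) :
    IsLiftedArc n m (e.map (shift n m t)) where
  isPresent := by
    intro p hp
    obtain ⟨q, hq, rfl⟩ := Sym2.mem_map.1 hp
    exact (h.isPresent q hq).shift t
  not_contractible := by
    rw [Sym2.isDiag_map (shift_strictMono t).injective]
    exact h.not_contractible
  not_meridian h' := h.not_meridian <| by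
    rw [← map_shift_neg_map_shift (n := n) (m := m) t e, h']
    rfl
  not_boundary h' := h.not_boundary <| by
    rw [← map_shift_neg_map_shift (n := n) (m := m) t e]
    exact h'.map_shift _
  simple s h' := h.simple s <| by
    rw [map_shift_comm] at h'
    simpa only [map_shift_neg_map_shift] using h'.map_shift (n := n) (m := m) (-t)

theorem lower_lower {p q : ℤ} (hpq : p + 1 < q) (hn : q - p ≤ n) :
    IsLiftedArc n m s(lower p, lower q) where
  isPresent := by simp [IsPresent]
  not_contractible := by
    simp only [Sym2.mk_isDiag_iff, lower.injEq]
    omega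
  not_meridian := by simp
  not_boundary := by rw [isBoundarySegment_lower] <;> omega
  simple t := by
    rw [Sym2.map_mk, crosses_mk_iff (by simp; omega)]
    simp only [shift, Set.mem_Ioo, Set.mem_Icc, lower_lt_lower, lower_le_lower]
    rcases lt_trichotomy t 0 with ht | rfl | ht
    · have : t * n ≤ -n := by nlinarith
      omega
    · omega
    · have : (n : ℤ) ≤ t * n := by nlinarith
      omega

theorem left_lower (r : ℤ) : IsLiftedArc n m s(left, lower r) where
  isPresent := by simp [IsPresent]
  not_contractible := by simp
  not_meridian := by simp
  not_boundary := by simp [IsBoundarySegment]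
  simple t := by simp [crosses_mk_iff, shift]

theorem lower_right (r : ℤ) : IsLiftedArc n m s(lower r, right) where
  isPresent := by simp [IsPresent]
  not_contractible := by simp
  not_meridian := by simp
  not_boundary := by simp [IsBoundarySegment]
  simple t := by simp [crosses_mk_iff, shift, lower_lt_right.le]

theorem lower_upper (hm : 0 < m) (r u : ℤ) : IsLiftedArc n m s(lower r, upper u) where
  isPresent := by simp [IsPresent, hm]
  not_contractible := by simp
  not_meridian := by simp
  not_boundary := by simp [IsBoundarySegment]
  simple t := by
    rw [Sym2.map_mk, crosses_mk_iff lower_lt_upper]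
    simp only [shift, Set.mem_Ioo, Set.mem_Icc, lower_lt_lower, lower_lt_upper, upper_lt_upper,
      lower_le_lower, upper_le_upper, lower_lt_upper.le, true_and, and_true, not_le]
    rcases lt_trichotomy t 0 with ht | rfl | ht
    · have : t * n ≤ 0 := by nlinarith
      have : t * m ≤ 0 := by nlinarith
      omega
    · omega
    · have : 0 ≤ t * n := by positivity
      have : 0 ≤ t * m := by positivity
      omega

end IsLiftedArc

namespace AnnulusArc

open Set

variable {n m : ℕ} {T : Set (AnnulusArc n m)}

theorem map_shift_mem_preimage {e : Sym2 StripPoint} (h : e ∈ preimage T) (t : ℤ) :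
    e.map (shift n m t) ∈ preimage T := by
  obtain ⟨he, heT⟩ := h
  refine ⟨he.map_shift t, ?_⟩
  convert heT using 1
  exact Quotient.sound ⟨-t, map_shift_neg_map_shift t e⟩

theorem IsTriangulation.not_crosses (hT : IsTriangulation T) {e f : Sym2 StripPoint}
    (he : e ∈ preimage T) (hf : f ∈ preimage T) : ¬ Crosses e f := by
  obtain ⟨he, heT⟩ := he
  obtain ⟨hf, hfT⟩ := hf
  by_cases h : (Quotient.mk (deckSetoid n m) ⟨e, he⟩ : AnnulusArc n m) =
      Quotient.mk (deckSetoid n m) ⟨f, hf⟩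
  · obtain ⟨t, rfl : e.map (shift n m t) = f⟩ := Quotient.exact h
    exact he.simple t
  · exact hT.prop heT hfT h e ⟨he, rfl⟩ f ⟨hf, rfl⟩

theorem IsTriangulation.mem_preimage (hT : IsTriangulation T) {e : Sym2 StripPoint}
    (he : IsLiftedArc n m e) (h : ∀ f ∈ preimage T, ¬ Crosses e f) : e ∈ preimage T := by
  have compatible_lift : ∀ β ∈ T, ∀ e' ∈ preimage {Quotient.mk (deckSetoid n m) ⟨e, he⟩},
      ∀ f ∈ preimage {β}, ¬ Crosses e' f := by
    rintro β hβ e' ⟨he', hee'⟩ f ⟨hf, rfl⟩ hcr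
    obtain ⟨t, ht : e'.map (shift n m t) = e⟩ := Quotient.exact hee'
    exact h _ (map_shift_mem_preimage ⟨hf, hβ⟩ t) (ht ▸ hcr.map_shift t)
  refine ⟨he, hT.mem_of_prop_insert <| pairwise_insert.2 ⟨hT.prop, fun β hβ _ => ⟨?_, ?_⟩⟩⟩
  · exact compatible_lift β hβ
  · exact fun f hf e' he' hcr => compatible_lift β hβ e' he' f hf hcr.symm

/-- The points are joined by a side of the lifted triangulation: a lifted arc or a boundary
segment. -/
def Joined (T : Set (AnnulusArc n m)) (p q : StripPoint) : Prop :=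
  s(p, q) ∈ preimage T ∨ IsBoundarySegment m s(p, q)

namespace Joined

variable {p q : StripPoint}

theorem symm (h : Joined T p q) : Joined T q p := by
  rwa [Joined, Sym2.eq_swap]

theorem ne (h : Joined T p q) : p ≠ q := by
  rcases h with ⟨h, -⟩ | ⟨k, h⟩ | ⟨-, k, h⟩
  · exact h.not_contractible
  all_goals
    rintro rfl
    obtain ⟨rfl, h⟩ | ⟨rfl, h⟩ := Sym2.eq_iff.1 h <;> simp at h

theorem isPresent_right (h : Joined T p q) : q.IsPresent m := by
  rcases h with ⟨h, -⟩ | ⟨k, h⟩ | ⟨hm, -⟩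
  · exact h.isPresent q (Sym2.mem_mk_right p q)
  · rcases Sym2.eq_iff.1 h with ⟨-, rfl⟩ | ⟨-, rfl⟩ <;> trivial
  · cases q <;> trivial

theorem shift (h : Joined T p q) (t : ℤ) : Joined T (p.shift n m t) (q.shift n m t) :=
  h.imp (map_shift_mem_preimage · t) (·.map_shift (n := n) t)

end Joined

theorem joined_succ (k : ℤ) : Joined T (lower k) (lower (k + 1)) := Or.inr (Or.inl ⟨k, rfl⟩)

theorem Joined.sub_le (hn : 0 < n) {k l : ℤ} (h : Joined T (lower k) (lower l)) : l - k ≤ n := by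
  by_contra! hlt
  have hkl : k < l := by omega
  rcases h with h | h
  · refine h.1.simple 1 ((crosses_mk_iff (by simpa)).2 ?_)
    simp only [StripPoint.shift, one_mul, Set.mem_Ioo, Set.mem_Icc, lower_lt_lower, lower_le_lower]
    omega
  · rw [isBoundarySegment_lower hkl] at h
    omega

namespace IsTriangulation

theorem mem_Icc (hT : IsTriangulation T) {a b c d : StripPoint} (hab : Joined T a b)
    (hcd : Joined T c d) (hc : c ∈ Ioo a b) : d ∈ Icc a b := by
  by_contra hd
  have hcr : Crosses s(a, b) s(c, d) := (crosses_mk_iff (hc.1.trans hc.2)).2 (Or.inl ⟨hc, hd⟩)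
  rcases hab with hab | hab
  · rcases hcd with hcd | hcd
    · exact hT.not_crosses hab hcd hcr
    · exact hcd.not_crosses hcr.symm
  · exact hab.not_crosses hcr

theorem joined_of_forall_mem_Icc (hT : IsTriangulation T) {a b : StripPoint} (hab : a < b)
    (he : IsLiftedArc n m s(a, b)) (h : ∀ c d, Joined T c d → c ∈ Ioo a b → d ∈ Icc a b) :
    Joined T a b := by
  refine Or.inl (hT.mem_preimage he fun f hf hcr => ?_)
  induction f with | _ c d
  rcases (crosses_mk_iff hab).1 hcr with ⟨hc, hd⟩ | ⟨hd, hc⟩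
  · exact hd (h c d (Or.inl hf) hc)
  · exact hc (h d c (Joined.symm (Or.inl hf)) hd)

theorem exists_below (hT : IsTriangulation T) (hn : 0 < n) {p q : ℤ} (hpq : p + 1 < q)
    (h : Joined T (lower p) (lower q)) :
    ∃ x ∈ Ioo p q, Joined T (lower p) (lower x) ∧ Joined T (lower x) (lower q) := by
  -- The third vertex is the neighbour of `p` farthest to the right.
  obtain ⟨x, ⟨hx, hpx⟩, hmax⟩ := Int.exists_greatest_of_bdd
    (P := fun x => x ∈ Ioo p q ∧ Joined T (lower p) (lower x))
    ⟨q, fun x hx => hx.1.2.le⟩ ⟨p + 1, ⟨lt_add_one p, hpq⟩, joined_succ p⟩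
  refine ⟨x, hx, hpx, ?_⟩
  obtain ⟨hx_left, hx_right⟩ := hx
  rcases (Int.add_one_le_of_lt hx_right).eq_or_lt with rfl | hxq
  · exact joined_succ x
  have hlen := h.sub_le hn
  refine hT.joined_of_forall_mem_Icc (by simpa) (.lower_lower hxq (by omega)) fun c d hcd hc => ?_
  have hd := hT.mem_Icc h hcd (Ioo_subset_Ioo_left (by simpa using hx_left.le) hc)
  obtain ⟨c, -, rfl⟩ := exists_eq_lower_of_mem_Icc (Ioo_subset_Icc_self hc)
  obtain ⟨d, -, rfl⟩ := exists_eq_lower_of_mem_Icc hd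
  have h_left := hT.mem_Icc hpx hcd.symm
  simp only [Set.mem_Ioo, Set.mem_Icc, lower_lt_lower, lower_le_lower] at hc hd h_left ⊢
  have hpd : p ≠ d := by
    rintro rfl
    exact hc.1.not_ge (hmax c ⟨⟨hx_left.trans hc.1, hc.2⟩, hcd.symm⟩)
  omega

theorem exists_above_of_joined_outside (hT : IsTriangulation T) (hn : 0 < n) {k p q l : ℤ}
    (hpq : p < q) (h : Joined T (lower p) (lower q)) (hkl : Joined T (lower k) (lower l))
    (hkp : k ≤ p) (hql : q ≤ l) (hne : k < p ∨ q < l) :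
    ∃ x ∉ Icc (lower p) (lower q), Joined T (lower p) x ∧ Joined T (lower q) x := by
  induction hd : (l - k).toNat using Nat.strong_induction_on generalizing k l with
  | _ d ih =>
    obtain ⟨x, ⟨hkx, hxl⟩, hk, hl⟩ := hT.exists_below hn (by omega) hkl
    rcases le_or_gt x p with hxp | hxp
    · by_cases hxq : x = p ∧ q = l
      · obtain ⟨rfl, rfl⟩ := hxq
        exact ⟨lower k, by simp [hkx], hk.symm, hkl.symm⟩
      · exact ih _ (by omega) hl hxp hql (by omega) rfl
    rcases le_or_gt q x with hqx | hqx
    · by_cases hkx' : k = p ∧ q = x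
      · obtain ⟨rfl, rfl⟩ := hkx'
        exact ⟨lower l, by simp [hxl], hkl, hl⟩
      · exact ih _ (by omega) hk hkp hqx (by omega) rfl
    have hx : lower x ∈ Ioo (lower p) (lower q) := by simp [hxp, hqx]
    have hk' := hT.mem_Icc h hk.symm hx
    have hl' := hT.mem_Icc h hl hx
    simp only [Set.mem_Icc, lower_le_lower] at hk' hl'
    omega

end IsTriangulation

/-- The lower marked point `r` can be reached from the upper side: no side between lower marked
points passes over it. -/
def IsUncovered (T : Set (AnnulusArc n m)) (r : ℤ) : Prop :=
  ∀ k l, Joined T (lower k) (lower l) → r ∉ Ioo k l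

theorem exists_lt_add_mul (hn : 0 < n) (k w : ℤ) : ∃ t : ℤ, w < k + t * n :=
  ⟨|w - k| + 1, by nlinarith [le_abs_self (w - k), abs_nonneg (w - k)]⟩

theorem exists_add_mul_lt (hn : 0 < n) (k w : ℤ) : ∃ t : ℤ, k + t * n < w := by
  obtain ⟨t, ht⟩ := exists_lt_add_mul hn w k
  exact ⟨-t, by linarith⟩

namespace IsTriangulation

/-- An arc crossing that from `-∞` to `r` is confined by a far translate of the arc from `-∞` to
`k`, so it would pass over `r`. -/
theorem joined_left (hT : IsTriangulation T) (hn : 0 < n) {k r : ℤ}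
    (h : Joined T left (lower k)) (hr : IsUncovered T r) : Joined T left (lower r) := by
  refine hT.joined_of_forall_mem_Icc left_lt_lower (.left_lower r) fun c d hcd hc => ?_
  refine ⟨left_le d, ?_⟩
  by_contra! hd
  obtain ⟨w, rfl⟩ := exists_eq_lower hc.1 (hc.2.trans lower_lt_right)
  obtain ⟨t, ht⟩ := exists_lt_add_mul hn k w
  have hd' := hT.mem_Icc (h.shift t) hcd (by simpa [shift] using ht)
  obtain ⟨w', -, rfl⟩ := exists_eq_lower_of_mem_Icc ⟨hd.le, hd'.2⟩
  exact hr w w' hcd ⟨by simpa using hc.2, by simpa using hd⟩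

theorem joined_right (hT : IsTriangulation T) (hn : 0 < n) {k r : ℤ}
    (h : Joined T (lower k) right) (hr : IsUncovered T r) : Joined T (lower r) right := by
  refine hT.joined_of_forall_mem_Icc lower_lt_right (.lower_right r) fun c d hcd hc => ?_
  obtain ⟨w, rfl⟩ := exists_eq_lower (left_lt_lower.trans hc.1) hc.2
  obtain ⟨t, ht⟩ := exists_add_mul_lt hn k w
  have hd := hT.mem_Icc (h.shift t) hcd (by simpa [shift] using ht)
  refine ⟨?_, hd.2⟩
  by_contra! hdr
  obtain ⟨w', -, rfl⟩ := exists_eq_lower_of_mem_Icc ⟨hd.1, hdr.le⟩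
  exact hr w' w hcd.symm ⟨by simpa using hdr, by simpa using hc.1⟩

theorem joined_upper (hT : IsTriangulation T) (hn : 0 < n) {l r u : ℤ} (hlr : l ≤ r)
    (h : Joined T (lower l) (upper u)) (hr : IsUncovered T r)
    (hmax : ∀ w ∈ Ico l r, ∀ v, Joined T (lower w) (upper v) → v ≤ u) :
    Joined T (lower r) (upper u) := by
  refine hT.joined_of_forall_mem_Icc lower_lt_upper (.lower_upper h.isPresent_right r u)
    fun c d hcd hc => ?_
  have hd := hT.mem_Icc h hcd (Ioo_subset_Ioo_left (by simpa) hc)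
  refine ⟨?_, hd.2⟩
  by_contra! hdr
  obtain ⟨w, -, rfl⟩ := exists_eq_lower_of_mem_Icc ⟨hd.1, hdr.le⟩
  rw [lower_lt_lower] at hdr
  rcases c with _ | k | _ | v
  · simp [not_lt_of_gt] at hc
  · exact hr w k hcd.symm ⟨hdr, by simpa using hc.1⟩
  · obtain ⟨t, ht⟩ := exists_lt_add_mul hn l w
    have := (hT.mem_Icc (h.shift t) hcd (by simp [shift])).1
    simp only [shift, lower_le_lower] at this
    omega
  · refine (upper_lt_upper.1 hc.2).not_ge (hmax w ⟨?_, hdr⟩ v hcd.symm)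
    simpa using hd.1

/-- The upper ends of the bridging arcs that start at `p` or to the left of it have a rightmost one,
by periodicity, and no side separates this one from `p` or `q`. -/
theorem exists_upper_of_isUncovered (hT : IsTriangulation T) (hn : 0 < n) {k p q v : ℤ}
    (hpq : p < q) (h : Joined T (lower p) (lower q)) (hp : IsUncovered T p) (hq : IsUncovered T q)
    (hkv : Joined T (lower k) (upper v)) :
    ∃ u, Joined T (lower p) (upper u) ∧ Joined T (lower q) (upper u) := by
  have bounded : ∃ b, ∀ u, (∃ l ≤ p, Joined T (lower l) (upper u)) → u ≤ b := by
    obtain ⟨t, ht⟩ := exists_lt_add_mul hn k p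
    refine ⟨v + t * m, fun u ⟨l, hl, hlu⟩ => ?_⟩
    by_contra! hu
    have := (hT.mem_Icc (hkv.shift t) hlu.symm (by simpa [shift] using hu)).1
    simp only [shift, lower_le_lower] at this
    omega
  obtain ⟨t, ht⟩ := exists_add_mul_lt hn k p
  obtain ⟨u, ⟨l, hl, hlu⟩, hmax⟩ :=
    Int.exists_greatest_of_bdd bounded ⟨v + t * m, k + t * n, ht.le, hkv.shift t⟩
  have hpu := hT.joined_upper hn hl hlu hp fun w hw v hwv => hmax v ⟨w, hw.2.le, hwv⟩
  refine ⟨u, hpu, hT.joined_upper hn hpq.le hpu hq fun w hw v hwv => ?_⟩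
  rcases hw.1.eq_or_lt with rfl | hpw
  · exact hmax v ⟨p, le_rfl, hwv⟩
  · have := (hT.mem_Icc h hwv (by simp [hpw, hw.2])).2
    simp at this

theorem exists_joined_ne_lower (hT : IsTriangulation T) {r : ℤ} (hr : IsUncovered T r) :
    ∃ k x, Joined T (lower k) x ∧ ∀ l, x ≠ lower l := by
  by_contra! h
  have hleft : Joined T left (lower r) := by
    refine hT.joined_of_forall_mem_Icc left_lt_lower (.left_lower r) fun c d hcd hc => ?_
    obtain ⟨w, rfl⟩ := exists_eq_lower hc.1 (hc.2.trans lower_lt_right)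
    obtain ⟨w', rfl⟩ := h w d hcd
    refine ⟨left_le _, not_lt.1 fun hw => ?_⟩
    exact hr w w' hcd ⟨by simpa using hc.2, by simpa using hw⟩
  obtain ⟨l, hl⟩ := h r left hleft.symm
  simp at hl

theorem exists_above (hT : IsTriangulation T) (hn : 0 < n) {p q : ℤ} (hpq : p < q)
    (h : Joined T (lower p) (lower q)) :
    ∃ x ∉ Icc (lower p) (lower q), Joined T (lower p) x ∧ Joined T (lower q) x := by
  by_cases hcov : ∃ k l, Joined T (lower k) (lower l) ∧ k ≤ p ∧ q ≤ l ∧ (k < p ∨ q < l)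
  · obtain ⟨k, l, hkl, hkp, hql, hne⟩ := hcov
    exact hT.exists_above_of_joined_outside hn hpq h hkl hkp hql hne
  push Not at hcov
  have hp : IsUncovered T p := fun k l hkl hp => by
    have := hT.mem_Icc h hkl.symm
    simp only [Set.mem_Ioo, Set.mem_Icc, lower_lt_lower, lower_le_lower] at this hp
    have := hcov k l hkl
    omega
  have hq : IsUncovered T q := fun k l hkl hq => by
    have := hT.mem_Icc h hkl
    simp only [Set.mem_Ioo, Set.mem_Icc, lower_lt_lower, lower_le_lower] at this hq
    have := hcov k l hkl
    omega
  obtain ⟨k, _ | l | _ | v, hkx, hx⟩ := hT.exists_joined_ne_lower hp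
  · have joined_left {r} (hr : IsUncovered T r) := (hT.joined_left hn hkx.symm hr).symm
    exact ⟨left, by simp, joined_left hp, joined_left hq⟩
  · exact absurd rfl (hx l)
  · exact ⟨right, by simp, hT.joined_right hn hkx hp, hT.joined_right hn hkx hq⟩
  · obtain ⟨u, hpu, hqu⟩ := hT.exists_upper_of_isUncovered hn hpq h hp hq hkx
    exact ⟨upper u, by simp, hpu, hqu⟩

theorem eq_of_joined_outside (hT : IsTriangulation T) {a b x y : StripPoint} (hab : a < b)
    (hx : x ∉ Icc a b) (hax : Joined T a x) (hbx : Joined T b x) (hy : y ∉ Icc a b)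
    (hay : Joined T a y) (hby : Joined T b y) : x = y := by
  wlog hxy : x < y generalizing x y
  · rcases (not_lt.1 hxy).eq_or_lt with rfl | hyx
    · rfl
    · exact (this hy hay hby hx hax hbx hyx).symm
  exfalso
  simp only [Set.mem_Icc, not_and_or, not_le] at hx hy
  rcases hx with hxa | hbx'
  · rcases hy with hya | hby'
    · exact hab.not_ge (hT.mem_Icc hax.symm hby.symm ⟨hxy, hya⟩).2
    · exact hby'.not_ge (hT.mem_Icc hbx.symm hay ⟨hxa, hab⟩).2
  · exact hxy.not_ge (hT.mem_Icc hax hby ⟨hab, hbx'⟩).2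

end IsTriangulation

namespace IsTriangle

variable {t : Finset StripPoint} {p q r : StripPoint}

theorem of_joined (hpq : Joined T p q) (hqr : Joined T q r) (hpr : Joined T p r) :
    IsTriangle T {p, q, r} := by
  refine ⟨Finset.card_eq_three.2 ⟨p, q, r, hpq.ne, hpr.ne, hqr.ne, rfl⟩, ?_⟩
  have := hpq.symm
  have := hqr.symm
  have := hpr.symm
  simp only [Finset.mem_insert, Finset.mem_singleton, ← Joined.eq_1]
  grind

theorem joined (ht : IsTriangle T t) (hp : p ∈ t) (hq : q ∈ t) (hpq : p ≠ q) : Joined T p q :=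
  ht.2 p hp q hq hpq

theorem exists_eq (ht : IsTriangle T t) (hp : p ∈ t) (hq : q ∈ t) (hpq : p ≠ q) :
    ∃ r, t = {p, q, r} ∧ Joined T p r ∧ Joined T q r := by
  obtain ⟨r, hr, hrpq⟩ := Finset.exists_mem_notMem_of_card_lt_card (s := {p, q}) (t := t)
    (by rw [ht.1, Finset.card_pair hpq]; norm_num)
  simp only [Finset.mem_insert, Finset.mem_singleton, not_or] at hrpq
  have hpr := Ne.symm hrpq.1
  have hqr := Ne.symm hrpq.2
  refine ⟨r, (Finset.eq_of_subset_of_card_le ?_ ?_).symm, ht.joined hp hr hpr, ht.joined hq hr hqr⟩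
  · simp [Finset.insert_subset_iff, hp, hq, hr]
  · rw [ht.1, Finset.card_eq_three.2 ⟨p, q, r, hpq, hpr, hqr, rfl⟩]

theorem image_shift (ht : IsTriangle T t) (s : ℤ) : IsTriangle T (t.image (shift n m s)) := by
  refine ⟨by rw [Finset.card_image_of_injective _ (shift_strictMono s).injective, ht.1], ?_⟩
  intro p hp q hq hpq
  obtain ⟨x, hx, rfl⟩ := Finset.mem_image.1 hp
  obtain ⟨y, hy, rfl⟩ := Finset.mem_image.1 hq
  exact (ht.joined hx hy (ne_of_apply_ne _ hpq)).shift s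

end IsTriangle

theorem IsTriangulation.existsUnique_triangle_above (hT : IsTriangulation T) (hn : 0 < n) {k l : ℤ}
    (hkl : k < l) (h : Joined T (lower k) (lower l)) :
    ∃! t, IsTriangle T t ∧ lower k ∈ t ∧ lower l ∈ t ∧ ∀ q ∈ Ioo k l, lower q ∉ t := by
  obtain ⟨x, hx, hkx, hlx⟩ := hT.exists_above hn hkl h
  refine ⟨{lower k, lower l, x}, ⟨.of_joined h hlx hkx, by simp, by simp, ?_⟩, ?_⟩
  · rintro q ⟨hkq, hql⟩ hq
    obtain rfl : x = lower q := by simpa [hkq.ne, hql.ne', eq_comm (a := lower q)] using hq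
    exact hx (by simp [hkq.le, hql.le])
  · rintro t ⟨ht, hk, hl, ht_above⟩
    obtain ⟨y, rfl, hky, hly⟩ := ht.exists_eq hk hl h.ne
    have hy : y ∉ Icc (lower k) (lower l) := fun hy => by
      obtain ⟨q, hq, rfl⟩ := exists_eq_lower_of_mem_Icc hy
      refine ht_above q ⟨hq.1.lt_of_ne ?_, hq.2.lt_of_ne ?_⟩ (by simp)
      · rintro rfl
        exact hky.ne rfl
      · rintro rfl
        exact hly.ne rfl
    rw [hT.eq_of_joined_outside (by simpa) hx hkx hlx hy hky hly]

section Fans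

variable {fan : ℤ → Finset (Finset StripPoint)}
  (hfan : ∀ k t, t ∈ fan k ↔ IsTriangle T t ∧ lower k ∈ t)

include hfan

theorem joined_of_mem_fan {k l : ℤ} {t : Finset StripPoint} (hk : t ∈ fan k) (hl : t ∈ fan l)
    (hkl : k ≠ l) : Joined T (lower k) (lower l) :=
  ((hfan k t).1 hk).1.joined ((hfan k t).1 hk).2 ((hfan l t).1 hl).2 (by simpa)

theorem existsUnique_fan_above (hT : IsTriangulation T) (hn : 0 < n) {k l : ℤ}
    (hkl : k < l) (h : Joined T (lower k) (lower l)) :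
    ∃! t, t ∈ fan k ∧ t ∈ fan l ∧ t ∉ beneath fan k l := by
  obtain ⟨t, ⟨ht, hk, hl, ht_above⟩, hunique⟩ := hT.existsUnique_triangle_above hn hkl h
  simp only [mem_beneath, Finset.mem_Ioo, hfan]
  refine ⟨t, ⟨⟨ht, hk⟩, ⟨ht, hl⟩, fun ⟨q, hq, _, hqt⟩ => ht_above q hq hqt⟩, ?_⟩
  rintro u ⟨⟨hu, huk⟩, ⟨-, hul⟩, hu_above⟩
  exact hunique u ⟨hu, huk, hul, fun q hq hqu => hu_above ⟨q, hq, hu, hqu⟩⟩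

theorem isFanSystem (hT : IsTriangulation T) (hn : 0 < n) : IsFanSystem fan where
  exists_consecutive k := by
    obtain ⟨t, ⟨hk, hl, -⟩, -⟩ := existsUnique_fan_above hfan hT hn (lt_add_one k) (joined_succ k)
    exact ⟨t, hk, hl⟩
  mem_Icc {k l q r t u} hk hl hq hr hq_mem := by
    rw [Finset.mem_Ioo] at hq_mem
    rw [Finset.mem_Icc]
    rcases eq_or_ne q r with rfl | hqr
    · exact ⟨hq_mem.1.le, hq_mem.2.le⟩
    · simpa using hT.mem_Icc (joined_of_mem_fan hfan hk hl (hq_mem.1.trans hq_mem.2).ne)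
        (joined_of_mem_fan hfan hq hr hqr) (by simpa using hq_mem)
  exists_peripheral := by
    rintro k l ⟨hkl, t, hk, hl⟩ hlt
    have h := joined_of_mem_fan hfan hk hl hkl.ne
    obtain ⟨q, ⟨hkq, hql⟩, hkx, hxl⟩ := hT.exists_below hn hlt h
    have ht := IsTriangle.of_joined hkx hxl h
    exact ⟨_, q, hkq, hql, (hfan _ _).2 ⟨ht, by simp⟩, (hfan _ _).2 ⟨ht, by simp⟩,
      (hfan _ _).2 ⟨ht, by simp⟩⟩
  exists_ne {k l q t u} ht hu hut := by
    have hkl := joined_of_mem_fan hfan ht.mem_left ht.mem_right (ht.left_lt.trans ht.lt_right).ne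
    obtain ⟨-, htq⟩ := (hfan q t).1 ht.mem_mid
    obtain ⟨htri, htk⟩ := (hfan k t).1 ht.mem_left
    obtain ⟨-, htl⟩ := (hfan l t).1 ht.mem_right
    obtain ⟨hutri, huq⟩ := (hfan q u).1 hu
    obtain ⟨x, hxu, hxt⟩ := Finset.not_subset.1 fun hsub =>
      hut (Finset.eq_of_subset_of_card_le hsub (htri.1.trans hutri.1.symm).le)
    have hqx := hutri.joined huq hxu (ne_of_mem_of_not_mem htq hxt)
    obtain ⟨r, hr, rfl⟩ := exists_eq_lower_of_mem_Icc <|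
      hT.mem_Icc hkl hqx ⟨by simpa using ht.left_lt, by simpa using ht.lt_right⟩
    have ne_r {s : ℤ} (hs : lower s ∈ t) : s ≠ r := fun hsr => hxt (hsr ▸ hs)
    exact ⟨r, Finset.mem_Ioo.2 ⟨hr.1.lt_of_ne (ne_r htk), hr.2.lt_of_ne (ne_r htl).symm⟩,
      (ne_r htq).symm, (hfan r u).2 ⟨hutri, hxu⟩⟩
  existsUnique_above := by
    rintro k l ⟨hkl, t, hk, hl⟩
    exact existsUnique_fan_above hfan hT hn hkl (joined_of_mem_fan hfan hk hl hkl.ne)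

theorem matchings_eq_hallMatchingsOn (i j : ℤ) :
    matchings T i j = hallMatchingsOn fan (Finset.Icc i j) := by
  simp only [matchings, hallMatchingsOn, hfan]

end Fans

theorem image_shift_triangles (k s : ℤ) :
    Finset.image (shift n m s) '' {t | IsTriangle T t ∧ lower k ∈ t} =
      {t | IsTriangle T t ∧ lower (k + s * n) ∈ t} := by
  apply Subset.antisymm
  · rintro _ ⟨t, ⟨ht, hk⟩, rfl⟩
    exact ⟨ht.image_shift s, Finset.mem_image_of_mem (shift n m s) hk⟩
  · rintro t ⟨ht, hk⟩
    refine ⟨t.image (shift n m (-s)), ⟨ht.image_shift (-s), ?_⟩, ?_⟩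
    · simpa [shift] using Finset.mem_image_of_mem (shift n m (-s)) hk
    · rw [Finset.image_image, shift_comp, neg_add_cancel, shift_zero, Finset.image_id]

theorem quiddity_add_mul (k s : ℤ) : quiddity T (k + s * n) = quiddity T k := by
  rw [quiddity, ← image_shift_triangles, ncard_image_of_injective, quiddity]
  exact Finset.image_injective (shift_strictMono s).injective

theorem Realizes.quiddity_eq {F : InfiniteFrieze} (hTF : Realizes T F) (hF : F.HasPeriod n)
    (hn : 0 < n) (k : ℤ) : (quiddity T k : ℤ) = F.quiddity k := by
  have hn' : (0 : ℤ) < n := by exact_mod_cast hn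
  have hk : (k - 1) % n + 1 + (k - 1) / n * n = k := by
    linarith [Int.emod_add_mul_ediv (k - 1) n]
  have hrem_nonneg := Int.emod_nonneg (k - 1) hn'.ne'
  have hrem_lt := Int.emod_lt_of_pos (k - 1) hn'
  have hperiod := Function.Periodic.int_mul hF ((k - 1) / n) ((k - 1) % n + 1)
  rw [Int.cast_id] at hperiod
  rw [← hk, quiddity_add_mul, hperiod]
  exact hTF _ (by omega) (by omega)

end AnnulusArc

theorem corollary5p8 (n m : ℕ) (hn : 0 < n) (F : InfiniteFrieze) (hF : F.HasPeriod n)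
    (T : Set (AnnulusArc n m)) (hT : AnnulusArc.IsTriangulation T)
    (hTF : AnnulusArc.Realizes T F) :
    ∀ i j : ℤ, i ≤ j →
      (AnnulusArc.matchings T i j).Finite ∧
        ((AnnulusArc.matchings T i j).ncard : ℤ) = F.entry i j := by
  intro i j hij
  have hquiddity (k : ℤ) : (AnnulusArc.quiddity T k : ℤ) = F.quiddity k := hTF.quiddity_eq hF hn k
  have hfinite (k : ℤ) : {t | AnnulusArc.IsTriangle T t ∧ lower k ∈ t}.Finite := by
    refine Set.finite_of_ncard_pos (Int.natCast_pos.1 ?_)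
    exact (hquiddity k).trans_gt (F.entry_pos k k le_rfl)
  let fan (k : ℤ) := (hfinite k).toFinset
  have hfan (k : ℤ) t : t ∈ fan k ↔ AnnulusArc.IsTriangle T t ∧ lower k ∈ t :=
    (hfinite k).mem_toFinset
  have hcard (k : ℤ) : ((fan k).card : ℤ) = F.quiddity k := by
    rw [← hquiddity, AnnulusArc.quiddity, Set.ncard_eq_toFinset_card _ (hfinite k)]
  rw [AnnulusArc.matchings_eq_hallMatchingsOn hfan]
  exact ⟨Set.toFinite _,
    (AnnulusArc.isFanSystem hfan hT hn).matchingCount_Icc_eq_entry F hcard hij⟩
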